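/- A parametric timed automaton (PTA) consists of finite sets of actions, locations, clocks and parameters, an initial location, an invariant (a guard) for each location, and a finite set of edges $(\ell,g,a,R,\ell')$ with source $\ell$, guard $g$, action $a$, set $R$ of clocks to be reset, and target $\ell'$. A guard is a finite conjunction of inequalities $x\bowtie d$ or $x\bowtie p$ with ${\bowtie}\in\{<,\le,=,\ge,>\}$, $x$ a clock, $d\in\mathbb N$ and $p$ a parameter. Clocks take values in $\mathbb R_{\ge 0}$, and a parameter valuation $v$ maps parameters to $\mathbb Q_{\ge 0}$; $v(\mathcal A)$ is the timed automaton obtained from $\mathcal A$ by replacing each parameter $p$ by $v(p)$, with its usual semantics: runs start in the initial location with all clocks $0$ and alternate delays and edges, and the invariants hold throughout. A set $T$ of locations is reachable in $v(\mathcal A)$ if some finite run of $v(\mathcal A)$ ends in a location of $T$. For a PTA $\mathcal A$, a parameter $p$ of $\mathcal A$ and a set $T$ of locations of $\mathcal A$, let $S(\mathcal A,p,T)=\{v(p) : v \text{ a parameter valuation such that } T \text{ is reachable in } v(\mathcal A)\}\subseteq\mathbb Q_{\ge 0}$. The minimum $\mathit{MinParamReach}(\mathcal A,p,T)$ is $\infty$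 if $S(\mathcal A,p,T)=\emptyset$; otherwise, if $S(\mathcal A,p,T)$ has a rational infimum $c$, it is $(c,=)$ if $c\in S(\mathcal A,p,T)$, and $(c,>)$ if $c\notin S(\mathcal A,p,T)$. **Proposition.** The solution to the minimal-parameter reachability problem for PTAs cannot be computed in general: 1. There is no algorithm (partial recursive function) that, given a PTA $\mathcal A$, a parameter $p$ and a set $T$ of locations of $\mathcal A$, returns $\mathit{MinParamReach}(\mathcal A,p,T)$ whenever this minimum exists. 2. This remains true on the instances with a single target location that is reachable for some parameter valuation and for which the minimum is attained: there is no algorithm that, given a PTA $\mathcal A$, a parameter $p$ and a location $\ell$ of $\mathcal A$, returns the least element of $S(\mathcal A,p,\{\ell\})$ whenever this least element exists. (In both items nothing is required of the algorithm, not even termination, on the other instances.) -/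

import Mathlib

open scoped NNReal NNRat

/-- The comparison operators `<`, `≤`, `=`, `≥`, `>` allowed in guards. -/
inductive Cmp where
  | lt | le | eq | ge | gt

/-- `c.holds x y` means `x ⋈ y`, where `⋈` is the operator `c`. -/
def Cmp.holds : Cmp → ℝ≥0 → ℝ≥0 → Prop
  | .lt, x, y => x < y
  | .le, x, y => x ≤ y
  | .eq, x, y => x = y
  | .ge, x, y => x ≥ y
  | .gt, x, y => x > y

/-- An inequality `x ⋈ d` or `x ⋈ p`, with `x` a clock. The right-hand side is `Sum.inl d` for a
natural number constant `d`, and `Sum.inr p` for a parameter `p`. Clocks and parameters are named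
by natural numbers. -/
structure Atom where
  clock : ℕ
  cmp : Cmp
  bound : ℕ ⊕ ℕ

/-- A guard: a finite conjunction of inequalities. -/
abbrev Guard := List Atom

/-- An edge `(src, guard, action, resets, tgt)`. -/
structure Edge where
  src : ℕ
  guard : Guard
  action : ℕ
  resets : List ℕ
  tgt : ℕ

/-- The finite syntax of a parametric timed automaton. The finite sets of actions, locations,
clocks and parameters are `{0, …, actions - 1}`, `{0, …, locs - 1}`, `{0, …, clocks - 1}` and
`{0, …, params - 1}`; the `l`-th entry of the list `inv` is the invariant of location `l`. -/
structure PTA where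
  actions : ℕ
  locs : ℕ
  clocks : ℕ
  params : ℕ
  init : ℕ
  inv : List Guard
  edges : List Edge

/-! ### Well-formedness: all the names used are declared -/

def Atom.WellFormed (A : PTA) (a : Atom) : Prop :=
  a.clock < A.clocks ∧ ∀ p : ℕ, a.bound = Sum.inr p → p < A.params

def Guard.WellFormed (A : PTA) (g : Guard) : Prop :=
  ∀ a ∈ g, a.WellFormed A

structure Edge.WellFormed (A : PTA) (e : Edge) : Prop where
  src : e.src < A.locs
  guard : Guard.WellFormed A e.guard
  action : e.action < A.actions
  resets : ∀ x ∈ e.resets, x < A.clocks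
  tgt : e.tgt < A.locs

structure PTA.WellFormed (A : PTA) : Prop where
  init : A.init < A.locs
  inv_length : A.inv.length = A.locs
  inv : ∀ g ∈ A.inv, Guard.WellFormed A g
  edges : ∀ e ∈ A.edges, e.WellFormed A

/-! ### Semantics -/

/-- Clock valuations. Only the values at the clocks of the automaton matter. -/
abbrev ClockVal := ℕ → ℝ≥0

/-- Parameter valuations, with nonnegative rational values. Only the values at the parameters of
the automaton matter. -/
abbrev ParamVal := ℕ → ℚ≥0

/-- The value of a right-hand side under a parameter valuation. -/
def boundVal (v : ParamVal) : ℕ ⊕ ℕ → ℝ≥0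
  | Sum.inl d => (d : ℝ≥0)
  | Sum.inr p => ((v p : ℚ≥0) : ℝ≥0)

/-- `w ⊨ v(g)`. -/
def Guard.Sat (g : Guard) (v : ParamVal) (w : ClockVal) : Prop :=
  ∀ a ∈ g, a.cmp.holds (w a.clock) (boundVal v a.bound)

/-- The clock valuation `w + d`. -/
def ClockVal.delay (w : ClockVal) (d : ℝ≥0) : ClockVal := fun x => w x + d

/-- The clock valuation `[w]_R`, where the clocks in `R` are set to zero. -/
def ClockVal.reset (w : ClockVal) (R : List ℕ) : ClockVal := fun x => if x ∈ R then 0 else w x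

namespace PTA

/-- The invariant of a location. -/
def invariant (A : PTA) (l : ℕ) : Guard := A.inv.getD l []

/-- Concrete states of `v(A)`: a location and a clock valuation satisfying its invariant. -/
def IsState (A : PTA) (v : ParamVal) (s : ℕ × ClockVal) : Prop :=
  s.1 < A.locs ∧ (A.invariant s.1).Sat v s.2

/-- The initial state: the initial location, with all clocks equal to zero. -/
def initState (A : PTA) : ℕ × ClockVal := (A.init, fun _ => 0)

/-- The delay transition of duration `d`. -/
def DelayStep (A : PTA) (v : ParamVal) (d : ℝ≥0) (s s' : ℕ × ClockVal) : Prop :=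
  s' = (s.1, s.2.delay d) ∧ ∀ d' : ℝ≥0, d' ≤ d → A.IsState v (s.1, s.2.delay d')

/-- The discrete transition along the edge `e`. -/
def DiscreteStep (A : PTA) (v : ParamVal) (e : Edge) (s s' : ℕ × ClockVal) : Prop :=
  e ∈ A.edges ∧ A.IsState v s ∧ A.IsState v s' ∧ s.1 = e.src ∧ e.guard.Sat v s.2 ∧
    s' = (e.tgt, s.2.reset e.resets)

/-- One step of a run: a delay followed by a discrete transition. -/
def Step (A : PTA) (v : ParamVal) (s s' : ℕ × ClockVal) : Prop :=
  ∃ (d : ℝ≥0) (e : Edge) (s'' : ℕ × ClockVal), A.DelayStep v d s s'' ∧ A.DiscreteStep v e s'' s'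

/-- `s` is the last state of a finite run of `v(A)`. -/
def ReachableState (A : PTA) (v : ParamVal) (s : ℕ × ClockVal) : Prop :=
  A.IsState v A.initState ∧ Relation.ReflTransGen (A.Step v) A.initState s

/-- Some location in `T` is reachable in `v(A)`. -/
def Reaches (A : PTA) (v : ParamVal) (T : List ℕ) : Prop :=
  ∃ l ∈ T, ∃ w : ClockVal, A.ReachableState v (l, w)

/-- The set of the values `v(p)`, over all parameter valuations `v` such that `T` is reachable
in `v(A)`. -/
def reachValues (A : PTA) (p : ℕ) (T : List ℕ) : Set ℚ≥0 :=
  {c | ∃ v : ParamVal, A.Reaches v T ∧ v p = c}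

end PTA

/-! ### Minima -/

/-- A minimum: `∞`, or a pair `(c, =)` or `(c, >)` with `c` a nonnegative rational number. -/
inductive Minimum where
  | infinity
  | attained (c : ℚ≥0)
  | justAbove (c : ℚ≥0)

/-- `m` is the minimum of the set `S`: the infimum of `S`, tagged with whether it belongs to `S`,
and `∞` if `S` is empty. -/
def IsMinimum (S : Set ℚ≥0) : Minimum → Prop
  | .infinity => S = ∅
  | .attained c => IsLeast S c
  | .justAbove c => S.Nonempty ∧ IsGLB S c ∧ c ∉ S

/-- `m` is the solution to the minimal-parameter reachability problem for the automaton `A`, the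
parameter `p` and the target set `T`. -/
def IsMinParamReach (A : PTA) (p : ℕ) (T : List ℕ) (m : Minimum) : Prop :=
  IsMinimum (A.reachValues p T) m

/-! ### Finite representations of inputs and outputs -/

/-- The pair `(a, b)` of natural numbers represents the rational number `a / (b + 1)`. -/
def ratOfCode (q : ℕ × ℕ) : ℚ≥0 := (q.1 : ℚ≥0) / ((q.2 : ℚ≥0) + 1)

/-- Representation of minima by finite data: `none` stands for `∞`, and `some (q, b)` for
`(c, =)` if `b` is `true` and for `(c, >)` if `b` is `false`, with `c` represented by `q`. -/
def minimumOfCode : Option ((ℕ × ℕ) × Bool) → Minimum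
  | none => .infinity
  | some (q, true) => .attained (ratOfCode q)
  | some (q, false) => .justAbove (ratOfCode q)

def Cmp.equivFin : Cmp ≃ Fin 5 where
  toFun
    | .lt => 0
    | .le => 1
    | .eq => 2
    | .ge => 3
    | .gt => 4
  invFun
    | 0 => .lt
    | 1 => .le
    | 2 => .eq
    | 3 => .ge
    | 4 => .gt
  left_inv c := by cases c <;> rfl
  right_inv i := by fin_cases i <;> rfl

def Atom.equivProd : Atom ≃ ℕ × Cmp × (ℕ ⊕ ℕ) where
  toFun a := (a.clock, a.cmp, a.bound)
  invFun t := ⟨t.1, t.2.1, t.2.2⟩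
  left_inv _ := rfl
  right_inv _ := rfl

def Edge.equivProd : Edge ≃ ℕ × List Atom × ℕ × List ℕ × ℕ where
  toFun e := (e.src, e.guard, e.action, e.resets, e.tgt)
  invFun t := ⟨t.1, t.2.1, t.2.2.1, t.2.2.2.1, t.2.2.2.2⟩
  left_inv _ := rfl
  right_inv _ := rfl

def PTA.equivProd : PTA ≃ ℕ × ℕ × ℕ × ℕ × ℕ × List (List Atom) × List Edge where
  toFun A := (A.actions, A.locs, A.clocks, A.params, A.init, A.inv, A.edges)
  invFun t := ⟨t.1, t.2.1, t.2.2.1, t.2.2.2.1, t.2.2.2.2.1, t.2.2.2.2.2.1, t.2.2.2.2.2.2⟩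
  left_inv _ := rfl
  right_inv _ := rfl

instance Cmp.instPrimcodable : Primcodable Cmp := Primcodable.ofEquiv (Fin 5) Cmp.equivFin

instance Atom.instPrimcodable : Primcodable Atom :=
  Primcodable.ofEquiv (ℕ × Cmp × (ℕ ⊕ ℕ)) Atom.equivProd

instance Edge.instPrimcodable : Primcodable Edge :=
  Primcodable.ofEquiv (ℕ × List Atom × ℕ × List ℕ × ℕ) Edge.equivProd

instance PTA.instPrimcodable : Primcodable PTA :=
  Primcodable.ofEquiv (ℕ × ℕ × ℕ × ℕ × ℕ × List (List Atom) × List Edge) PTA.equivProd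

/-! The halting problem reduces to minimal-parameter reachability. For a partial recursive `g` and
an input `n`, an automaton is built whose target is always reachable with parameter `0` equal to
`1`, and otherwise only with parameter `0` equal to `0`, which works exactly if `g n` is defined.
The set of values is thus `{1}` or `{0, 1}`: its least element always exists, and computing it
decides the domain of `g`. A `g` with undecidable domain gives item 2, and item 1 follows by
restriction to singleton targets.

First, `g` is computed by a nondeterministic register program that can only zero, increment and test
equality; guessing and then testing replaces copying and branching (`FlowComputable.of_partrec'`).
Such a program is then run on clocks: they circulate modulo a period `P`, which is parameter `1`,
and a register is the phase of clock `0` relative to its own clock. For every rational `P` and every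
run, even one that lets clocks exceed `P`, the phases follow a genuine run of the program
(`flowPTA_sound`). Conversely an accepting run involves finitely many values, so every large enough
integer `P` can replay it (`flowPTA_complete`). As `P` is not the minimized parameter, no bound on
it is needed in advance. `flowPTA_reachValues` combines the two directions. -/

open Relation Function

/-! ### Nondeterministic flow programs and their closure properties -/

/-- The instructions of flow programs, acting on registers with natural number values. -/
inductive Instr where
  | zero (j : ℕ)
  | inc (j : ℕ)
  | eq (i j : ℕ)

namespace Instr

/-- The transition relation of an instruction: `zero` and `inc` are assignments, and `eq` is a
test. -/
def Rel : Instr → (ℕ → ℕ) → (ℕ → ℕ) → Prop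
  | zero j, s, s' => s' = update s j 0
  | inc j, s, s' => s' = update s j (s j + 1)
  | eq i j, s, s' => s i = s j ∧ s' = s

/-- All registers of the instruction are smaller than `k`. -/
def RegsLT (k : ℕ) : Instr → Prop
  | zero j => j < k
  | inc j => j < k
  | eq i j => i < k ∧ j < k

theorem RegsLT.mono {k k' : ℕ} (h : k ≤ k') : ∀ {i : Instr}, i.RegsLT k → i.RegsLT k'
  | zero _, hi => lt_of_lt_of_le hi h
  | inc _, hi => lt_of_lt_of_le hi h
  | eq _ _, hi => ⟨hi.1.trans_le h, hi.2.trans_le h⟩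

theorem exists_regsLT : ∀ i : Instr, ∃ k, i.RegsLT k
  | zero j => ⟨j + 1, Nat.lt_succ_self j⟩
  | inc j => ⟨j + 1, Nat.lt_succ_self j⟩
  | eq i j => ⟨i + j + 1, by constructor <;> omega⟩

end Instr

/-- One step of the flow program with the labelled edges `E`. -/
def FlowStep {Q : Type} (E : List (Q × Instr × Q)) (x y : Q × (ℕ → ℕ)) : Prop :=
  ∃ i : Instr, (x.1, i, y.1) ∈ E ∧ i.Rel x.2 y.2

/-- A relation on register contents is realizable if it is the input-output relation of a finite
nondeterministic flow program. -/
def Realizable (R : (ℕ → ℕ) → (ℕ → ℕ) → Prop) : Prop :=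
  ∃ (Q : Type) (_ : Finite Q) (E : List (Q × Instr × Q)) (a b : Q),
    ∀ s s', R s s' ↔ ReflTransGen (FlowStep E) (a, s) (b, s')

namespace Realizable

theorem instr (i : Instr) : Realizable i.Rel := by
  refine ⟨Bool, inferInstance, [(false, i, true)], false, true,
    fun s s' => ⟨fun h => ?_, fun h => ?_⟩⟩
  · exact .single ⟨i, by simp, h⟩
  · have key : ∀ y, ReflTransGen (FlowStep [(false, i, true)]) (false, s) y →
        (y = (false, s)) ∨ (y.1 = true ∧ i.Rel s y.2) := by
      intro y hy
      induction hy with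
      | refl => exact .inl rfl
      | tail _ hstep ih =>
        obtain ⟨j, hj, hr⟩ := hstep
        simp only [List.mem_singleton, Prod.mk.injEq] at hj
        obtain ⟨h1, rfl, h2⟩ := hj
        rcases ih with rfl | ⟨h, -⟩
        · exact .inr ⟨h2, hr⟩
        · simp [h1] at h
    rcases key _ h with h | h
    · simp at h
    · exact h.2

theorem comp {R S : (ℕ → ℕ) → (ℕ → ℕ) → Prop} (hR : Realizable R) (hS : Realizable S) :
    Realizable (Relation.Comp R S) := by
  obtain ⟨Q₁, _, E₁, a₁, b₁, h₁⟩ := hR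
  obtain ⟨Q₂, _, E₂, a₂, b₂, h₂⟩ := hS
  set E : List ((Q₁ ⊕ Q₂) × Instr × (Q₁ ⊕ Q₂)) :=
    -- The test `eq 0 0` always succeeds and changes nothing, so it serves as a silent jump. No edge
    -- leads back from the right summand to the left one.
    (.inl b₁, .eq 0 0, .inr a₂) :: (E₁.map fun e => (.inl e.1, e.2.1, .inl e.2.2)) ++
      E₂.map fun e => (.inr e.1, e.2.1, .inr e.2.2) with hE
  refine ⟨Q₁ ⊕ Q₂, inferInstance, E, .inl a₁, .inr b₂, fun s s' => ⟨fun h => ?_, fun h => ?_⟩⟩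
  · obtain ⟨t, ht, ht'⟩ := h
    have l₁ : ReflTransGen (FlowStep E) (.inl a₁, s) (.inl b₁, t) :=
      ((h₁ s t).1 ht).lift (fun x : Q₁ × (ℕ → ℕ) => ((.inl x.1 : Q₁ ⊕ Q₂), x.2))
        fun x y ⟨i, hi, hr⟩ => ⟨i, by simp [hE, hi], hr⟩
    have l₂ : ReflTransGen (FlowStep E) (.inr a₂, t) (.inr b₂, s') :=
      ((h₂ t s').1 ht').lift (fun x : Q₂ × (ℕ → ℕ) => ((.inr x.1 : Q₁ ⊕ Q₂), x.2))
        fun x y ⟨i, hi, hr⟩ => ⟨i, by simp [hE, hi], hr⟩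
    have l : FlowStep E (.inl b₁, t) (.inr a₂, t) := ⟨.eq 0 0, by simp [hE], rfl, rfl⟩
    exact (l₁.tail l).trans l₂
  · have key : ∀ y, ReflTransGen (FlowStep E) (.inl a₁, s) y →
        (∀ q, y.1 = .inl q → ReflTransGen (FlowStep E₁) (a₁, s) (q, y.2)) ∧
        (∀ q, y.1 = .inr q → ∃ t, R s t ∧ ReflTransGen (FlowStep E₂) (a₂, t) (q, y.2)) := by
      intro y hy
      induction hy with
      | refl => exact ⟨fun q hq => by simp at hq; subst hq; exact .refl, by simp⟩
      | @tail y z _ hstep ih =>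
        obtain ⟨j, hj, hr⟩ := hstep
        obtain ⟨y, w⟩ := y
        obtain ⟨z, w'⟩ := z
        simp only [hE, List.cons_append, List.mem_cons, List.mem_append, List.mem_map,
          Prod.mk.injEq] at hj
        rcases hj with ⟨rfl, rfl, rfl⟩ | ⟨⟨q, i, q'⟩, he, rfl, rfl, rfl⟩ |
          ⟨⟨q, i, q'⟩, he, rfl, rfl, rfl⟩
        · obtain ⟨-, rfl⟩ := hr
          refine ⟨by simp, fun q hq => ?_⟩
          simp at hq; subst hq
          exact ⟨_, (h₁ _ _).2 (ih.1 _ rfl), .refl⟩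
        · refine ⟨fun q'' hq => ?_, by simp⟩
          simp at hq; subst hq
          exact (ih.1 _ rfl).tail ⟨i, he, hr⟩
        · refine ⟨by simp, fun q'' hq => ?_⟩
          simp at hq; subst hq
          obtain ⟨t, ht, ht'⟩ := ih.2 _ rfl
          exact ⟨t, ht, ht'.tail ⟨i, he, hr⟩⟩
    obtain ⟨t, ht, ht'⟩ := (key _ h).2 _ rfl
    exact ⟨t, ht, (h₂ _ _).2 ht'⟩

/-- The extra state `none` is both entry and exit. A run is at `none` only between complete passes
through the program, even if the inner program itself revisits its entry or exit. -/
theorem star {R : (ℕ → ℕ) → (ℕ → ℕ) → Prop} (hR : Realizable R) :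
    Realizable (ReflTransGen R) := by
  obtain ⟨Q, _, E₁, a, b, h₁⟩ := hR
  set E : List (Option Q × Instr × Option Q) :=
    (none, .eq 0 0, some a) :: (some b, .eq 0 0, none) ::
      E₁.map fun e => (some e.1, e.2.1, some e.2.2) with hE
  refine ⟨Option Q, inferInstance, E, none, none, fun s s' => ⟨fun h => ?_, fun h => ?_⟩⟩
  · induction h with
    | refl => exact .refl
    | @tail t t' _ ht ih =>
      have l : ReflTransGen (FlowStep E) (some a, t) (some b, t') :=
        ((h₁ t t').1 ht).lift (fun x : Q × (ℕ → ℕ) => (some x.1, x.2))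
          fun x y ⟨i, hi, hr⟩ => ⟨i, by simp [hE, hi], hr⟩
      have l' : FlowStep E (none, t) (some a, t) := ⟨.eq 0 0, by simp [hE], rfl, rfl⟩
      exact ((ih.tail l').trans l).tail ⟨.eq 0 0, by simp [hE], rfl, rfl⟩
  · have key : ∀ y, ReflTransGen (FlowStep E) (none, s) y →
        (y.1 = none → ReflTransGen R s y.2) ∧
        (∀ q, y.1 = some q → ∃ t, ReflTransGen R s t ∧
          ReflTransGen (FlowStep E₁) (a, t) (q, y.2)) := by
      intro y hy
      induction hy with
      | refl => exact ⟨fun _ => .refl, by simp⟩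
      | @tail y z _ hstep ih =>
        obtain ⟨j, hj, hr⟩ := hstep
        obtain ⟨y, w⟩ := y
        obtain ⟨z, w'⟩ := z
        simp only [hE, List.mem_cons, List.mem_map, Prod.mk.injEq] at hj
        rcases hj with ⟨rfl, rfl, rfl⟩ | ⟨rfl, rfl, rfl⟩ | ⟨⟨q, i, q'⟩, he, rfl, rfl, rfl⟩
        · obtain ⟨-, rfl⟩ := hr
          refine ⟨by simp, fun q hq => ?_⟩
          simp at hq; subst hq
          exact ⟨_, ih.1 rfl, .refl⟩
        · obtain ⟨-, rfl⟩ := hr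
          refine ⟨fun _ => ?_, by simp⟩
          obtain ⟨t, ht, ht'⟩ := ih.2 _ rfl
          exact ht.tail ((h₁ _ _).2 ht')
        · refine ⟨by simp, fun q'' hq => ?_⟩
          simp at hq; subst hq
          obtain ⟨t, ht, ht'⟩ := ih.2 _ rfl
          exact ⟨t, ht, ht'.tail ⟨i, he, hr⟩⟩
    exact (key _ h).1 rfl

end Realizable

namespace Realizable

theorem congr {R S : (ℕ → ℕ) → (ℕ → ℕ) → Prop} (hR : Realizable R)
    (h : ∀ s s', R s s' ↔ S s s') : Realizable S := by
  obtain rfl : R = S := by ext s s'; exact h s s'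
  exact hR

theorem const (j c : ℕ) : Realizable fun s s' => s' = update s j c := by
  induction c with
  | zero => exact instr (.zero j)
  | succ c ih =>
    refine (ih.comp (instr (.inc j))).congr fun s s' => ⟨?_, ?_⟩
    · rintro ⟨_, rfl, h⟩
      simpa [Instr.Rel] using h
    · rintro rfl
      exact ⟨_, rfl, by simp [Instr.Rel]⟩

theorem addAny (j : ℕ) : Realizable fun s s' => ∃ m, s' = update s j (s j + m) := by
  refine (instr (.inc j)).star.congr fun s s' => ⟨fun h => ?_, ?_⟩
  · induction h with
    | refl => exact ⟨0, by simp⟩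
    | tail _ h ih =>
      obtain ⟨m, rfl⟩ := ih
      exact ⟨m + 1, by simpa [Instr.Rel, add_assoc] using h⟩
  · rintro ⟨m, rfl⟩
    induction m with
    | zero => simpa using ReflTransGen.refl
    | succ m ih => exact ih.tail (by simp [Instr.Rel, add_assoc])

/-- The test `c ≤ s i` together with the assignment `t := s i`. -/
theorem copyOfLE {t i : ℕ} (h : t ≠ i) (c : ℕ) :
    Realizable fun s s' => c ≤ s i ∧ s' = update s t (s i) := by
  -- Guess the value `c + m` for `t` and keep only the runs where it equals register `i`; a suitable
  -- `m` exists exactly when `c ≤ s i`.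
  refine (((const t c).comp (addAny t)).comp (instr (.eq t i))).congr fun s s' => ⟨?_, ?_⟩
  · rintro ⟨_, ⟨_, rfl, m, rfl⟩, he, rfl⟩
    simp only [update_self, update_of_ne h.symm, update_idem] at he ⊢
    exact ⟨by omega, by rw [he]⟩
  · rintro ⟨hc, rfl⟩
    obtain ⟨m, hm⟩ := Nat.exists_eq_add_of_le hc
    refine ⟨_, ⟨_, rfl, m, rfl⟩, ?_, ?_⟩
    · simp [update_of_ne h.symm, hm]
    · simp [hm]

theorem copy {t i : ℕ} (h : t ≠ i) : Realizable fun s s' => s' = update s t (s i) :=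
  (copyOfLE h 0).congr fun s s' => by simp

end Realizable

/-! ### Partial recursive functions are flow-computable -/

/-- A partial function is flow-computable if, for all registers `a i` for its arguments, `o` for
its value and every bound `k` on these registers, there is a realizable relation that assigns the
value to `o` and does not change the other registers smaller than `k`. -/
def FlowComputable {n : ℕ} (f : List.Vector ℕ n →. ℕ) : Prop :=
  ∀ (a : Fin n → ℕ) (o k : ℕ), (∀ i, a i < k ∧ a i ≠ o) → o < k →
    ∃ R, Realizable R ∧
      (∀ s s', R s s' → s' o ∈ f (List.Vector.ofFn fun i => s (a i)) ∧
        ∀ j < k, j ≠ o → s' j = s j) ∧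
      ∀ s, (f (List.Vector.ofFn fun i => s (a i))).Dom → ∃ s', R s s'

theorem List.Vector.mem_mOfFn_iff {α : Type} {n : ℕ} {f : Fin n → Part α} {v : List.Vector α n} :
    v ∈ (List.Vector.mOfFn f : Part (List.Vector α n)) ↔ ∀ i, v.get i ∈ f i := by
  induction n with
  | zero => simp [List.Vector.mOfFn, Part.pure_eq_some, eq_iff_true_of_subsingleton]
  | succ n ih =>
    simp only [List.Vector.mOfFn, Part.bind_eq_bind, Part.mem_bind_iff, Part.pure_eq_some,
      Part.mem_some_iff, ih]
    constructor
    · rintro ⟨x, hx, w, hw, rfl⟩ i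
      refine Fin.cases ?_ (fun i => ?_) i
      · simpa using hx
      · simpa using hw i
    · intro h
      exact ⟨v.head, by simpa using h 0, v.tail, fun i => by simpa using h i.succ, by simp⟩

namespace FlowComputable

/-- The values go to the fresh registers from `k` on. Raising the bound by one for each function
protects the arguments and the values already computed. -/
theorem family {m n : ℕ} {g : Fin n → List.Vector ℕ m →. ℕ} (hg : ∀ i, FlowComputable (g i))
    (a : Fin m → ℕ) (k : ℕ) (ha : ∀ i, a i < k) :
    ∃ R, Realizable R ∧
      (∀ s s', R s s' → (∀ i : Fin n, s' (k + i) ∈ g i (List.Vector.ofFn fun i => s (a i))) ∧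
        ∀ j < k, s' j = s j) ∧
      ∀ s, (∀ i, (g i (List.Vector.ofFn fun i => s (a i))).Dom) → ∃ s', R s s' := by
  induction n with
  | zero =>
    refine ⟨_, .instr (.eq 0 0), fun s s' h => ?_, fun s _ => ⟨s, rfl, rfl⟩⟩
    obtain ⟨-, rfl⟩ := h
    exact ⟨fun i => i.elim0, fun _ _ => rfl⟩
  | succ n ih =>
    obtain ⟨R, hR, hs, hc⟩ := ih fun i => hg i.castSucc
    obtain ⟨R', hR', hs', hc'⟩ := hg (Fin.last n) a (k + n) (k + n + 1)
      (fun i => by have := ha i; omega) (by omega)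
    have args : ∀ s s', R s s' → (fun i => s' (a i)) = fun i => s (a i) := fun s s' h =>
      funext fun i => (hs s s' h).2 _ (ha i)
    refine ⟨_, hR.comp hR', ?_, fun s hd => ?_⟩
    · rintro s s' ⟨t, h₁, h₂⟩
      have h₃ := hs _ _ h₁
      have h₄ := hs' _ _ h₂
      rw [args _ _ h₁] at h₄
      refine ⟨fun i => ?_, fun j hj => ?_⟩
      · refine Fin.lastCases ?_ (fun i => ?_) i
        · exact h₄.1
        · have := i.2
          rw [Fin.val_castSucc, h₄.2 _ (by omega) (by omega)]
          exact h₃.1 i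
      · rw [h₄.2 _ (by omega) (by omega), h₃.2 _ hj]
    · obtain ⟨t, ht⟩ := hc s fun i => hd i.castSucc
      obtain ⟨s', hs'⟩ := hc' t (by rw [args _ _ ht]; exact hd _)
      exact ⟨s', t, ht, hs'⟩

theorem comp {m n : ℕ} {f : List.Vector ℕ n →. ℕ} {g : Fin n → List.Vector ℕ m →. ℕ}
    (hf : FlowComputable f) (hg : ∀ i, FlowComputable (g i)) :
    FlowComputable fun v => (List.Vector.mOfFn fun i => g i v) >>= f := by
  intro a o k ha ho
  obtain ⟨R, hR, hs, hc⟩ := family hg a k fun i => (ha i).1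
  obtain ⟨R', hR', hs', hc'⟩ := hf (fun i => k + i) o (k + n)
    (fun i => by have := i.2; constructor <;> omega) (by omega)
  have hv : ∀ s t, R s t → (List.Vector.ofFn fun i : Fin n => t (k + i)) ∈
      (List.Vector.mOfFn (fun i => g i (List.Vector.ofFn fun i => s (a i))) :
        Part (List.Vector ℕ n)) := fun s t h => by
    rw [List.Vector.mem_mOfFn_iff]
    simpa using (hs s t h).1
  refine ⟨_, hR.comp hR', ?_, fun s hd => ?_⟩
  · rintro s s' ⟨t, h₁, h₂⟩
    refine ⟨Part.mem_bind (hv s t h₁) (hs' _ _ h₂).1, fun j hj hjo => ?_⟩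
    rw [(hs' _ _ h₂).2 _ (by omega) hjo, (hs _ _ h₁).2 _ hj]
  · obtain ⟨y, hy⟩ := Part.dom_iff_mem.1 hd
    obtain ⟨v, hv', hy⟩ := Part.mem_bind_iff.1 hy
    obtain ⟨t, ht⟩ := hc s fun i =>
      Part.dom_iff_mem.2 ⟨_, List.Vector.mem_mOfFn_iff.1 hv' i⟩
    obtain ⟨s', hs'⟩ := hc' t (by
      rw [← Part.mem_unique hv' (hv s t ht)]
      exact Part.dom_iff_mem.2 ⟨_, hy⟩)
    exact ⟨s', t, ht, hs'⟩

/-- Register `k` counts the passes and `o` accumulates, so that `o` holds the recursion at stage `k`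
throughout. The number of passes is guessed and checked at the end against the recursion argument.
-/
theorem prec {n : ℕ} {f : List.Vector ℕ n → ℕ} {g : List.Vector ℕ (n + 2) → ℕ}
    (hf : FlowComputable (f : List.Vector ℕ n →. ℕ))
    (hg : FlowComputable (g : List.Vector ℕ (n + 2) →. ℕ)) :
    FlowComputable (fun v : List.Vector ℕ (n + 1) =>
      (v.head.rec (f v.tail) fun y IH => g (y ::ᵥ IH ::ᵥ v.tail) : ℕ) :
        List.Vector ℕ (n + 1) →. ℕ) := by
  intro a o k ha ho
  obtain ⟨R, hR, hs, hc⟩ := hf (fun i => a i.succ) o (k + 2)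
    (fun i => ⟨by have := (ha i.succ).1; omega, (ha _).2⟩) (by omega)
  obtain ⟨R', hR', hs', hc'⟩ := hg (Fin.cons k (Fin.cons o fun i => a i.succ)) (k + 1) (k + 2)
    (fun i => by
      refine Fin.cases ?_ (fun i => Fin.cases ?_ (fun i => ?_) i) i
      · simp
      · simp only [Fin.cons_succ, Fin.cons_zero]; omega
      · have := (ha i.succ).1
        simp only [Fin.cons_succ]; omega)
    (by omega)
  -- The step function reads `o`, and an output register must differ from all arguments, so the new
  -- value passes through `k + 1`.
  set B := Relation.Comp (Relation.Comp R' fun s s' => s' = update s o (s (k + 1)))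
    (Instr.Rel (.inc k)) with hB
  have hBr : Realizable B := (hR'.comp (.copy (by omega))).comp (.instr _)
  set F : (ℕ → ℕ) → ℕ → ℕ := fun s m =>
    m.rec (f (.ofFn fun i => s (a i.succ))) fun y IH =>
      g (y ::ᵥ IH ::ᵥ .ofFn fun i => s (a i.succ)) with hF
  set I : (ℕ → ℕ) → (ℕ → ℕ) → Prop := fun s t => (∀ j < k, j ≠ o → t j = s j) ∧ t o = F s (t k)
    with hI
  have args : ∀ s t, I s t → (fun i : Fin n => t (a i.succ)) = fun i => s (a i.succ) :=
    fun s t h => funext fun i => h.1 _ (ha _).1 (ha _).2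
  have hinit : ∀ s t, Relation.Comp (Instr.Rel (.zero k)) R s t → I s t ∧ t k = 0 := by
    rintro s t ⟨_, rfl, h⟩
    have h' := hs _ _ h
    have hk : t k = 0 := by rw [h'.2 k (by omega) (by omega)]; simp
    refine ⟨⟨fun j hj hjo => ?_, ?_⟩, hk⟩
    · rw [h'.2 j (by omega) hjo, update_of_ne (by omega)]
    · rw [hk]
      have : (fun i : Fin n => update s k 0 (a i.succ)) = fun i => s (a i.succ) :=
        funext fun i => update_of_ne (by have := (ha i.succ).1; omega) _ _
      simpa [hF, this] using h'.1
  have hstep : ∀ s t t', I s t → B t t' → I s t' ∧ t' k = t k + 1 := by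
    rintro s t _ hIt ⟨_, ⟨u, hu, rfl⟩, rfl⟩
    have h' := hs' _ _ hu
    have h1 := h'.1
    simp only [List.Vector.ofFn, Fin.cons_zero, Fin.cons_succ, args s t hIt, hIt.2,
      PFun.coe_val, Part.mem_some_iff] at h1
    have hk : u k = t k := h'.2 k (by omega) (by omega)
    refine ⟨⟨fun j hj hjo => ?_, ?_⟩, ?_⟩
    · rw [update_of_ne (by omega), update_of_ne hjo, h'.2 j (by omega) (by omega), hIt.1 j hj hjo]
    · rw [update_of_ne (by omega), update_self, update_self, update_of_ne (by omega), hk, h1]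
    · rw [update_self, update_of_ne (by omega), hk]
  have hstar : ∀ s t t', I s t → ReflTransGen B t t' → I s t' := by
    intro s t t' hIt h
    induction h with
    | refl => exact hIt
    | tail _ h ih => exact (hstep _ _ _ ih h).1
  refine ⟨_, (((Realizable.instr (.zero k)).comp hR).comp hBr.star).comp
    (.instr (.eq k (a 0))), ?_, fun s _ => ?_⟩
  · rintro s s' ⟨u, ⟨t, h₁, h₂⟩, h₃, rfl⟩
    have hIu := hstar _ _ _ (hinit _ _ h₁).1 h₂
    refine ⟨?_, hIu.1⟩
    rw [hIu.2, h₃, hIu.1 _ (ha 0).1 (ha 0).2]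
    simp [hF, List.Vector.ofFn]
  · obtain ⟨t, ht⟩ := hc (update s k 0) (by simp)
    have ht : Relation.Comp (Instr.Rel (.zero k)) R s t := ⟨_, rfl, ht⟩
    have hm : ∀ m, ∃ u, ReflTransGen B t u ∧ u k = m := by
      intro m
      induction m with
      | zero => exact ⟨t, .refl, (hinit _ _ ht).2⟩
      | succ m ih =>
        obtain ⟨u, hu, rfl⟩ := ih
        obtain ⟨w, hw⟩ := hc' u (by simp)
        have hb : B u _ := ⟨_, ⟨w, hw, rfl⟩, rfl⟩
        exact ⟨_, hu.tail hb, (hstep _ _ _ (hstar _ _ _ (hinit _ _ ht).1 hu) hb).2⟩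
    obtain ⟨u, hu, hk⟩ := hm (s (a 0))
    refine ⟨u, u, ⟨t, ht, hu⟩, ?_, rfl⟩
    rw [hk, (hstar _ _ _ (hinit _ _ ht).1 hu).1 _ (ha 0).1 (ha 0).2]

/-- Register `k` is the candidate. Another pass of the loop demands a nonzero value at the candidate
and the exit demands the value zero, so the surviving guess stops exactly at the first zero. -/
theorem rfind {n : ℕ} {f : List.Vector ℕ (n + 1) → ℕ}
    (hf : FlowComputable (f : List.Vector ℕ (n + 1) →. ℕ)) :
    FlowComputable fun v => Nat.rfind fun n => Part.some (f (n ::ᵥ v) = 0) := by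
  intro a o k ha ho
  obtain ⟨R, hR, hs, hc⟩ := hf (Fin.cons k a) (k + 1) (k + 3)
    (fun i => by
      refine Fin.cases ?_ (fun i => ?_) i
      · simp
      · have := (ha i).1
        simp only [Fin.cons_succ]; omega)
    (by omega)
  set V : (ℕ → ℕ) → List.Vector ℕ n := fun s => .ofFn fun i => s (a i) with hV
  set I : (ℕ → ℕ) → (ℕ → ℕ) → Prop := fun s t =>
    (∀ j < k, t j = s j) ∧ ∀ m < t k, f (m ::ᵥ V s) ≠ 0 with hI
  have hRI : ∀ s t t', I s t → R t t' → t' (k + 1) = f (t k ::ᵥ V s) ∧ t' k = t k ∧ I s t' := by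
    intro s t t' hIt h
    have h' := hs _ _ h
    have hk : t' k = t k := h'.2 k (by omega) (by omega)
    refine ⟨?_, hk, fun j hj => ?_, by rw [hk]; exact hIt.2⟩
    · have h1 := h'.1
      simp only [List.Vector.ofFn, Fin.cons_zero, Fin.cons_succ, PFun.coe_val,
        Part.mem_some_iff] at h1
      rw [h1, hV]
      simp only [fun i => hIt.1 _ (ha i).1]
    · rw [h'.2 j (by omega) (by omega), hIt.1 j hj]
  -- Copying to the scratch register `k + 2` with lower bound `1` is the test that the value is
  -- nonzero.
  set B := Relation.Comp (Relation.Comp R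
    fun s s' => 1 ≤ s (k + 1) ∧ s' = update s (k + 2) (s (k + 1))) (Instr.Rel (.inc k)) with hB
  have hBr : Realizable B := (hR.comp (.copyOfLE (by omega) 1)).comp (.instr _)
  have hstep : ∀ s t t', I s t → B t t' → I s t' ∧ t' k = t k + 1 := by
    rintro s t _ hIt ⟨_, ⟨u, hu, hpos, rfl⟩, rfl⟩
    obtain ⟨h1, hk, hIu⟩ := hRI _ _ _ hIt hu
    refine ⟨⟨fun j hj => ?_, fun m hm => ?_⟩, ?_⟩
    · rw [update_of_ne (by omega), update_of_ne (by omega), hIu.1 j hj]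
    · rw [update_self, update_of_ne (by omega), hk] at hm
      rcases Nat.lt_succ_iff_lt_or_eq.1 hm with hm | rfl
      · exact hIt.2 m hm
      · omega
    · rw [update_self, update_of_ne (by omega), hk]
  have hstar : ∀ s t t', I s t → ReflTransGen B t t' → I s t' := by
    intro s t t' hIt h
    induction h with
    | refl => exact hIt
    | tail _ h ih => exact (hstep _ _ _ ih h).1
  have hinit : ∀ s, I s (update s k 0) := fun s =>
    ⟨fun j hj => update_of_ne (by omega) _ _, by simp⟩
  have hE : Realizable _ := (((Realizable.const k 0).comp hBr.star).comp hR).comp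
    (((Realizable.const (k + 2) 0).comp (.instr (.eq (k + 1) (k + 2)))).comp
      (Realizable.copy (t := o) (i := k) (by omega)))
  refine ⟨_, hE, ?_, fun s hd => ?_⟩
  · rintro s _ ⟨w, ⟨u, ⟨_, rfl, h₂⟩, h₃⟩, _, ⟨_, rfl, h₄, rfl⟩, rfl⟩
    have hIu := hstar _ _ _ (hinit s) h₂
    obtain ⟨h1, hk, hIw⟩ := hRI _ _ _ hIu h₃
    rw [update_self, update_of_ne (by omega), h1] at h₄
    refine ⟨?_, fun j hj hjo => ?_⟩
    · rw [update_self, update_of_ne (by omega), hk]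
      refine Nat.mem_rfind.2 ⟨by simpa using h₄, fun {m} hm => ?_⟩
      simpa using hIu.2 m hm
    · rw [update_of_ne hjo, update_of_ne (by omega), hIw.1 j hj]
  · obtain ⟨y, hy⟩ := Part.dom_iff_mem.1 hd
    have hy := Nat.mem_rfind.1 hy
    have hm : ∀ m ≤ y, ∃ u, ReflTransGen B (update s k 0) u ∧ u k = m := by
      intro m
      induction m with
      | zero => exact fun _ => ⟨_, .refl, by simp⟩
      | succ m ih =>
        intro hle
        obtain ⟨u, hu, rfl⟩ := ih (by omega)
        obtain ⟨w, hw⟩ := hc u (by simp)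
        have hIu := hstar _ _ _ (hinit s) hu
        have hne := hy.2 (m := u k) (by omega)
        have hb : B u _ := ⟨_, ⟨w, hw, by
          rw [(hRI _ _ _ hIu hw).1]
          simpa [Nat.one_le_iff_ne_zero] using hne, rfl⟩, rfl⟩
        exact ⟨_, hu.tail hb, (hstep _ _ _ hIu hb).2⟩
    obtain ⟨u, hu, rfl⟩ := hm y le_rfl
    obtain ⟨w, hw⟩ := hc u (by simp)
    refine ⟨_, w, ⟨u, ⟨_, rfl, hu⟩, hw⟩, _, ⟨_, rfl, ?_, rfl⟩, rfl⟩
    rw [update_self, update_of_ne (by omega), (hRI _ _ _ (hstar _ _ _ (hinit s) hu) hw).1]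
    simpa using hy.1

theorem of_primrec' {n : ℕ} {f : List.Vector ℕ n → ℕ} (hf : Nat.Primrec' f) :
    FlowComputable (f : List.Vector ℕ n →. ℕ) := by
  induction hf with
  | zero =>
    intro a o k _ _
    refine ⟨_, .const o 0, ?_, fun s _ => ⟨_, rfl⟩⟩
    rintro s _ rfl
    exact ⟨by simp, fun j _ hj => update_of_ne hj _ _⟩
  | succ =>
    intro a o k ha _
    refine ⟨_, (Realizable.copy (ha 0).2.symm).comp (.instr (.inc o)), ?_,
      fun s _ => ⟨_, _, rfl, rfl⟩⟩
    rintro s _ ⟨_, rfl, rfl⟩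
    exact ⟨by simp [List.Vector.ofFn], fun j _ hj => by rw [update_of_ne hj, update_of_ne hj]⟩
  | get i =>
    intro a o k ha _
    refine ⟨_, .copy (ha i).2.symm, ?_, fun s _ => ⟨_, rfl⟩⟩
    rintro s _ rfl
    exact ⟨by simp, fun j _ hj => update_of_ne hj _ _⟩
  | comp g _ _ hf hg =>
    have := hf.comp hg
    refine Eq.subst (motive := FlowComputable) (funext fun v => ?_) this
    simp only [PFun.coe_val, Vector.mOfFn_part_some]
    exact Part.bind_some _ _
  | prec _ _ hf hg => exact hf.prec hg

theorem of_partrec' {n : ℕ} {f : List.Vector ℕ n →. ℕ} (hf : Nat.Partrec' f) :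
    FlowComputable f := by
  induction hf with
  | prim hf => exact of_primrec' hf
  | comp _ _ _ hf hg => exact hf.comp hg
  | rfind _ hf => exact hf.rfind

end FlowComputable

/-! ### Flow programs accepting domains of partial recursive functions -/

/-- The domain of a partial recursive function is accepted by a flow program. -/
theorem exists_flow_of_partrec {f : ℕ →. ℕ} (hf : Partrec f) :
    ∃ (Q : Type) (_ : Finite Q) (E : List (Q × Instr × Q)) (a b : Q), ∀ n,
      (f n).Dom ↔ ∃ s, ReflTransGen (FlowStep E) (a, update (fun _ => 0) 0 n) (b, s) := by
  obtain ⟨R, ⟨Q, hQ, E, a, b, hE⟩, hs, hc⟩ :=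
    FlowComputable.of_partrec' (Nat.Partrec'.part_iff₁.2 hf) (fun _ => 0) 1 2 (by simp) (by simp)
  refine ⟨Q, hQ, E, a, b, fun n => ?_⟩
  simp only [← hE]
  constructor
  · intro h
    exact hc _ (by simpa [List.Vector.ofFn] using h)
  · rintro ⟨s, h⟩
    exact Part.dom_iff_mem.2 ⟨_, by simpa [List.Vector.ofFn] using (hs _ _ h).1⟩

/-- The domain of a partial recursive function is accepted by a flow program whose states are
the natural numbers below some bound. -/
theorem exists_natFlow_of_partrec {f : ℕ →. ℕ} (hf : Partrec f) :
    ∃ (N : ℕ) (E : List (ℕ × Instr × ℕ)) (a b : ℕ), a < N ∧ b < N ∧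
      (∀ e ∈ E, e.1 < N ∧ e.2.2 < N) ∧ ∀ n,
        (f n).Dom ↔ ∃ s, ReflTransGen (FlowStep E) (a, update (fun _ => 0) 0 n) (b, s) := by
  obtain ⟨Q, _, E, a, b, h⟩ := exists_flow_of_partrec hf
  obtain ⟨N, ⟨φ⟩⟩ := Finite.exists_equiv_fin Q
  refine ⟨N, E.map fun e => (φ e.1, e.2.1, φ e.2.2), φ a, φ b, (φ a).2, (φ b).2, ?_, fun n => ?_⟩
  · intro e he
    obtain ⟨e, -, rfl⟩ := List.mem_map.1 he
    exact ⟨(φ _).2, (φ _).2⟩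
  rw [h]
  refine exists_congr fun s => ⟨fun h => ?_, fun h => ?_⟩
  · exact h.lift (fun x : Q × (ℕ → ℕ) => ((φ x.1 : ℕ), x.2)) fun x y ⟨i, hi, hr⟩ =>
      ⟨i, List.mem_map.2 ⟨_, hi, rfl⟩, hr⟩
  · have key : ∀ y, ReflTransGen (FlowStep (E.map fun e => ((φ e.1 : ℕ), e.2.1, (φ e.2.2 : ℕ))))
        (↑(φ a), update (fun _ => 0) 0 n) y → ∃ q, y.1 = φ q ∧
          ReflTransGen (FlowStep E) (a, update (fun _ => 0) 0 n) (q, y.2) := by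
      intro y hy
      induction hy with
      | refl => exact ⟨a, rfl, .refl⟩
      | tail _ hstep ih =>
        obtain ⟨i, hi, hr⟩ := hstep
        obtain ⟨q, hq, ih⟩ := ih
        obtain ⟨⟨q₁, i', q₂⟩, he, heq⟩ := List.mem_map.1 hi
        simp only [Prod.mk.injEq] at heq
        obtain ⟨h₁, rfl, h₂⟩ := heq
        obtain rfl : q₁ = q := φ.injective (Fin.ext (h₁.trans hq))
        exact ⟨q₂, h₂.symm, ih.tail ⟨i', he, hr⟩⟩
    obtain ⟨q, hq, h⟩ := key _ h
    obtain rfl : b = q := φ.injective (Fin.ext hq)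
    exact h

theorem List.exists_regsLT (E : List (ℕ × Instr × ℕ)) :
    ∃ K, 0 < K ∧ ∀ e ∈ E, e.2.1.RegsLT K := by
  induction E with
  | nil => exact ⟨1, one_pos, by simp⟩
  | cons e E ih =>
    obtain ⟨K, hK, h⟩ := ih
    obtain ⟨k, hk⟩ := e.2.1.exists_regsLT
    refine ⟨max K k, by omega, fun e' he' => ?_⟩
    rcases List.mem_cons.1 he' with rfl | he'
    · exact hk.mono (le_max_right _ _)
    · exact (h e' he').mono (le_max_left _ _)

/-! ### Simulation of flow programs by timed automata

Parameter `1` is a period `P`, and every clock may be reset when it reaches `P`. The value of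
register `i` is the difference of clock `0` and clock `i + 1`, modulo `P`. -/

namespace Instr

/-- The guard of the edge simulating an instruction. -/
def guard : Instr → Guard
  | zero _ => [⟨0, .eq, .inl 0⟩]
  | inc j => [⟨j + 1, .eq, .inl 1⟩, ⟨0, .ge, .inl 1⟩, ⟨0, .lt, .inr 1⟩]
  | eq i j => [⟨i + 1, .eq, .inl 0⟩, ⟨j + 1, .eq, .inl 0⟩]

/-- The resets of the edge simulating an instruction. -/
def resets : Instr → List ℕ
  | zero j => [j + 1]
  | inc j => [j + 1]
  | eq _ _ => []

end Instr

/-- The edges of `flowPTA` other than the initial one. -/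
def flowEdges (N K : ℕ) (E : List (ℕ × Instr × ℕ)) (b : ℕ) : List Edge :=
  ⟨N, [⟨0, .eq, .inl 1⟩, ⟨0, .eq, .inr 0⟩], 0, [], N + 1⟩ ::
  ⟨b, [⟨0, .eq, .inl 0⟩, ⟨0, .eq, .inr 0⟩], 0, [], N + 1⟩ ::
  ((E.map fun e => ⟨e.1, e.2.1.guard, 0, e.2.1.resets, e.2.2⟩) ++
  ((List.range N).map fun l => ⟨l, [], 0, [], l⟩) ++
  (List.range N).flatMap fun l => (List.range (K + 1)).map fun x =>
    ⟨l, [⟨x, .eq, .inr 1⟩], 0, [x], l⟩)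

/-- The edge that writes the input `n` to register `0`. -/
def inputEdge (N a n : ℕ) : Edge := ⟨N, [⟨0, .eq, .inl n⟩, ⟨0, .lt, .inr 1⟩], 0, [1], a⟩

/-- An automaton whose location `N + 1` is reachable if parameter `0` is `1`, or if it is `0` and
the flow program `E` has a run from `a` to `b` with input `n`. -/
def flowPTA (N K : ℕ) (E : List (ℕ × Instr × ℕ)) (a b n : ℕ) : PTA where
  actions := 1
  locs := N + 2
  clocks := K + 1
  params := 2
  init := N
  inv := List.replicate (N + 2) []
  edges := inputEdge N a n :: flowEdges N K E b

theorem mem_flowPTA_edges {N K : ℕ} {E : List (ℕ × Instr × ℕ)} {a b n : ℕ} {e : Edge} :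
    e ∈ (flowPTA N K E a b n).edges ↔
      e = inputEdge N a n ∨
      e = ⟨N, [⟨0, .eq, .inl 1⟩, ⟨0, .eq, .inr 0⟩], 0, [], N + 1⟩ ∨
      e = ⟨b, [⟨0, .eq, .inl 0⟩, ⟨0, .eq, .inr 0⟩], 0, [], N + 1⟩ ∨
      (∃ q i q', (q, i, q') ∈ E ∧ e = ⟨q, i.guard, 0, i.resets, q'⟩) ∨
      (∃ l < N, e = ⟨l, [], 0, [], l⟩) ∨
      ∃ l < N, ∃ x < K + 1, e = ⟨l, [⟨x, .eq, .inr 1⟩], 0, [x], l⟩ := by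
  simp [flowPTA, flowEdges, eq_comm (a := e)]

theorem flowPTA_wellFormed {N K : ℕ} {E : List (ℕ × Instr × ℕ)} {a b : ℕ} (n : ℕ) (hK : 0 < K)
    (ha : a < N) (hb : b < N) (hE : ∀ e ∈ E, e.1 < N ∧ e.2.2 < N)
    (hEK : ∀ e ∈ E, e.2.1.RegsLT K) : (flowPTA N K E a b n).WellFormed where
  init := by simp [flowPTA]
  inv_length := by simp [flowPTA]
  inv g hg := by
    obtain rfl := List.eq_of_mem_replicate hg
    simp [Guard.WellFormed]
  edges e he := by
    rcases mem_flowPTA_edges.1 he with rfl | rfl | rfl | ⟨q, i, q', h, rfl⟩ | ⟨l, hl, rfl⟩ |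
      ⟨l, hl, x, hx, rfl⟩
    · constructor <;> simp [flowPTA, inputEdge, Guard.WellFormed, Atom.WellFormed] <;> omega
    · constructor <;> simp [flowPTA, Guard.WellFormed, Atom.WellFormed]
    · constructor <;> simp [flowPTA, Guard.WellFormed, Atom.WellFormed]; omega
    · have h₁ := hE _ h
      have h₂ := hEK _ h
      simp only at h₁ h₂
      cases i <;> constructor <;>
        simp_all [flowPTA, Guard.WellFormed, Atom.WellFormed, Instr.guard, Instr.resets,
          Instr.RegsLT] <;> omega
    · constructor <;> simp [flowPTA, Guard.WellFormed] <;> omega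
    · constructor <;> simp [flowPTA, Guard.WellFormed, Atom.WellFormed] <;> omega

section Step

variable {N K : ℕ} {E : List (ℕ × Instr × ℕ)} {a b n : ℕ} {v : ParamVal}

theorem flowPTA_isState {s : ℕ × ClockVal} :
    (flowPTA N K E a b n).IsState v s ↔ s.1 < N + 2 := by
  have : (flowPTA N K E a b n).invariant s.1 = [] := by
    simp only [PTA.invariant, flowPTA, List.getD_eq_getElem?_getD, List.getElem?_replicate]
    split <;> rfl
  rw [PTA.IsState, this]
  simp [Guard.Sat, flowPTA]

theorem flowPTA_step {l : ℕ} {w : ClockVal} (d : ℝ≥0) {e : Edge}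
    (he : e ∈ (flowPTA N K E a b n).edges) (hl : l = e.src) (hs : l < N + 2) (ht : e.tgt < N + 2)
    (hg : e.guard.Sat v (w.delay d)) :
    (flowPTA N K E a b n).Step v (l, w) (e.tgt, (w.delay d).reset e.resets) :=
  ⟨d, e, (l, w.delay d), ⟨rfl, fun _ _ => flowPTA_isState.2 hs⟩, he, flowPTA_isState.2 hs,
    flowPTA_isState.2 ht, hl, hg, rfl⟩

theorem flowPTA_step_cases {s s' : ℕ × ClockVal} (h : (flowPTA N K E a b n).Step v s s') :
    ∃ d, ∃ e ∈ (flowPTA N K E a b n).edges, s.1 = e.src ∧ e.guard.Sat v (s.2.delay d) ∧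
      s' = (e.tgt, (s.2.delay d).reset e.resets) := by
  obtain ⟨d, e, s'', ⟨rfl, -⟩, he, -, -, hl, hg, rfl⟩ := h
  exact ⟨d, e, he, hl, hg, rfl⟩

end Step

/-! ### Soundness of the simulation -/

/-- The clock valuation `w` represents the register contents `c`, for the period `P`. -/
def Phase (P : ℝ≥0) (w : ClockVal) (c : ℕ → ℕ) : Prop :=
  ∀ i, (c i : ℝ≥0) < P ∧ ∃ k : ℤ, (w 0 : ℝ) = w (i + 1) + c i + k * P

/-- Phases determine registers only modulo `P`; the bounds `0 ≤ x < P` single out one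
representative. -/
theorem eq_of_eq_add_intCast_mul {P x y : ℝ} {k : ℤ} (hx : 0 ≤ x) (hxP : x < P) (hy : 0 ≤ y)
    (hyP : y < P) (hxy : x = y + k * P) : x = y := by
  have hP : (0 : ℝ) < P := hx.trans_lt hxP
  have h1 : k < 1 := by
    by_contra! hk
    have : (1 : ℝ) ≤ k := by exact_mod_cast hk
    nlinarith
  have h2 : -1 < k := by
    by_contra! hk
    have : (k : ℝ) ≤ -1 := by exact_mod_cast hk
    nlinarith
  obtain rfl : k = 0 := by omega
  simpa using hxy

namespace Phase

variable {P : ℝ≥0} {w : ClockVal} {c : ℕ → ℕ}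

theorem delay (h : Phase P w c) (d : ℝ≥0) : Phase P (w.delay d) c := fun i => by
  obtain ⟨hc, k, hk⟩ := h i
  refine ⟨hc, k, ?_⟩
  simp only [ClockVal.delay, NNReal.coe_add]
  linarith

/-- Such a reset shifts one clock by `P`, which the integer multiple of `P` in `Phase` absorbs. The
sign depends on whether that clock is clock `0`. -/
theorem reset_period (h : Phase P w c) {x : ℕ} (hx : w x = P) : Phase P (w.reset [x]) c :=
  fun i => by
    obtain ⟨hc, k, hk⟩ := h i
    refine ⟨hc, ?_⟩
    rcases Nat.eq_zero_or_pos x with rfl | hx0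
    · refine ⟨k - 1, ?_⟩
      rw [hx] at hk
      simp [ClockVal.reset]
      linarith
    · by_cases hxi : x = i + 1
      · subst hxi
        refine ⟨k + 1, ?_⟩
        rw [hx] at hk
        simp [ClockVal.reset]
        linarith
      · refine ⟨k, ?_⟩
        have h1 : 0 ≠ x := by omega
        have h2 : ¬ i + 1 = x := fun h => hxi h.symm
        simp [ClockVal.reset, h1, h2, hk]

theorem reset_register (h : Phase P w c) {j m : ℕ} (hm : (m : ℝ≥0) < P) (hz : w 0 = m) :
    Phase P (w.reset [j + 1]) (update c j m) := fun i => by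
  by_cases hij : i = j
  · subst hij
    simp only [update_self]
    exact ⟨hm, 0, by simp [ClockVal.reset, hz]⟩
  · rw [update_of_ne hij]
    refine ⟨(h i).1, ?_⟩
    simpa [ClockVal.reset, hij] using (h i).2

end Phase

namespace Phase

variable {v : ParamVal} {w : ClockVal} {c : ℕ → ℕ}

/-- For `zero`, clock `0` is `0` at the reset, so the new phase is `0`. For `inc j`, clock `j + 1`
is `1`, so clock `0` minus `1` is congruent to `c j` modulo `P`; both lie in `[0, P)` and hence
agree, and the reset makes the phase `c j + 1`. The guard on clock `0` also rules out overflow. For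
`eq i j`, both clocks are `0`, so `c i` and `c j` are congruent to clock `0`, hence equal. -/
theorem instr (h : Phase (v 1 : ℚ≥0) w c) {i : Instr} (hg : i.guard.Sat v w) :
    ∃ c', i.Rel c c' ∧ Phase (v 1 : ℚ≥0) (w.reset i.resets) c' := by
  cases i with
  | zero j =>
    simp only [Instr.guard, Guard.Sat, List.mem_singleton, forall_eq, Cmp.holds, boundVal] at hg
    exact ⟨_, rfl, h.reset_register (m := 0) (by simpa using (h 0).1.bot_lt) hg⟩
  | inc j =>
    simp only [Instr.guard, Guard.Sat, List.mem_cons, List.not_mem_nil, or_false,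
      forall_eq_or_imp, forall_eq, Cmp.holds, boundVal, Nat.cast_one, ge_iff_le] at hg
    obtain ⟨h₁, h₂, h₃⟩ := hg
    obtain ⟨hc, k, hk⟩ := h j
    rw [h₁] at hk
    have hc' : (c j : ℝ) < (((v 1 : ℚ≥0) : ℝ≥0) : ℝ) := by exact_mod_cast hc
    have h₂' : (1 : ℝ) ≤ w 0 := by exact_mod_cast h₂
    have h₃' : (w 0 : ℝ) < (((v 1 : ℚ≥0) : ℝ≥0) : ℝ) := by exact_mod_cast h₃
    have hx : (w 0 : ℝ) - 1 = c j := by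
      refine eq_of_eq_add_intCast_mul (P := (((v 1 : ℚ≥0) : ℝ≥0) : ℝ)) (k := k)
        (by linarith) (by linarith) (by positivity) hc' ?_
      rw [hk]
      simp only [NNReal.coe_one]
      ring
    have hw : w 0 = (c j + 1 : ℕ) := by
      apply NNReal.coe_injective
      push_cast
      linarith
    exact ⟨_, rfl, h.reset_register (hw ▸ h₃) hw⟩
  | eq i j =>
    simp only [Instr.guard, Guard.Sat, List.mem_cons, List.not_mem_nil, or_false,
      forall_eq_or_imp, forall_eq, Cmp.holds, boundVal, Nat.cast_zero] at hg
    obtain ⟨h₁, h₂⟩ := hg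
    obtain ⟨hc, k, hk⟩ := h i
    obtain ⟨hc', k', hk'⟩ := h j
    have hr : w.reset (Instr.eq i j).resets = w := by
      funext x
      simp [ClockVal.reset, Instr.resets]
    rw [hr]
    refine ⟨c, ⟨?_, rfl⟩, h⟩
    rw [h₁] at hk
    rw [h₂] at hk'
    have : (c i : ℝ) = c j := by
      refine eq_of_eq_add_intCast_mul (P := (((v 1 : ℚ≥0) : ℝ≥0) : ℝ)) (k := k' - k)
        (by positivity) (by exact_mod_cast hc) (by positivity) (by exact_mod_cast hc') ?_
      push_cast at hk hk' ⊢
      linarith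
    exact_mod_cast this

end Phase

theorem ClockVal.delay_zero (w : ClockVal) : w.delay 0 = w := by
  funext x
  simp [ClockVal.delay]

theorem ClockVal.reset_nil (w : ClockVal) : w.reset [] = w := by
  funext x
  simp [ClockVal.reset]

section Soundness

variable {N K : ℕ} {E : List (ℕ × Instr × ℕ)} {a b n : ℕ} {v : ParamVal}

/-- Three invariants, by kind of location: no edge enters `N`, so its clocks are still zero; the
target `N + 1` is entered only by its two guarded edges; at a program location the phases encode a
reachable configuration. -/
theorem flowPTA_sound (ha : a < N) (hb : b < N) (hE : ∀ e ∈ E, e.1 < N ∧ e.2.2 < N)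
    {s : ℕ × ClockVal}
    (h : ReflTransGen ((flowPTA N K E a b n).Step v) (flowPTA N K E a b n).initState s) :
    (s.1 = N → ∀ x, s.2 x = 0) ∧
    (s.1 = N + 1 → v 0 = 1 ∨
      v 0 = 0 ∧ ∃ c, ReflTransGen (FlowStep E) (a, update (fun _ => 0) 0 n) (b, c)) ∧
    (s.1 < N → ∃ c, ReflTransGen (FlowStep E) (a, update (fun _ => 0) 0 n) (s.1, c) ∧
      Phase (v 1 : ℚ≥0) s.2 c) := by
  induction h with
  | refl => simp [PTA.initState, flowPTA]
  | @tail s s' _ hstep ih =>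
    obtain ⟨d, e, he, hl, hg, rfl⟩ := flowPTA_step_cases hstep
    obtain ⟨l, w⟩ := s
    simp only at hl hg ih ⊢
    obtain ⟨ih₁, ih₂, ih₃⟩ := ih
    rcases mem_flowPTA_edges.1 he with rfl | rfl | rfl | ⟨q, i, q', hi, rfl⟩ | ⟨l', hl', rfl⟩ |
      ⟨l', hl', x, hx, rfl⟩
    · simp only [inputEdge, Guard.Sat, List.mem_cons, List.not_mem_nil, or_false,
        forall_eq_or_imp, forall_eq, Cmp.holds, boundVal] at hg hl ⊢
      refine ⟨by omega, by omega, fun _ => ⟨_, .refl, fun i => ?_⟩⟩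
      have hw : ∀ x, w.delay d x = n := fun x => by
        rw [← hg.1]
        simp [ClockVal.delay, ih₁ hl]
      have hn : (n : ℝ≥0) < (v 1 : ℚ≥0) := hw 0 ▸ hg.2
      -- All clocks show `n` when the input edge is taken, and it resets clock `1` only: register
      -- `0` becomes `n`, the others `0`.
      rcases Nat.eq_zero_or_pos i with rfl | hi
      · exact ⟨by simpa using hn, 0, by simp [ClockVal.reset, hw]⟩
      · refine ⟨by simpa [update_of_ne hi.ne'] using hn.bot_lt, 0, ?_⟩
        simp [ClockVal.reset, hw, hi.ne']
    · simp only [Guard.Sat, List.mem_cons, List.not_mem_nil, or_false,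
        forall_eq_or_imp, forall_eq, Cmp.holds, boundVal] at hg hl ⊢
      refine ⟨by omega, fun _ => .inl ?_, by omega⟩
      have := hg.1.symm.trans hg.2
      exact_mod_cast this.symm
    · simp only [Guard.Sat, List.mem_cons, List.not_mem_nil, or_false,
        forall_eq_or_imp, forall_eq, Cmp.holds, boundVal] at hg hl ⊢
      refine ⟨by omega, fun _ => .inr ⟨?_, ?_⟩, by omega⟩
      · have := hg.1.symm.trans hg.2
        exact_mod_cast this.symm
      · obtain ⟨c, hc, -⟩ := ih₃ (by omega)
        exact ⟨c, hl ▸ hc⟩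
    · have := hE _ hi
      simp only at this hl hg ⊢
      refine ⟨by omega, by omega, fun _ => ?_⟩
      obtain ⟨c, hc, hp⟩ := ih₃ (by omega)
      obtain ⟨c', hr, hp'⟩ := (hp.delay d).instr hg
      exact ⟨c', hc.tail ⟨i, hl ▸ hi, hr⟩, hp'⟩
    · simp only at hl ⊢
      subst hl
      refine ⟨by omega, by omega, fun _ => ?_⟩
      obtain ⟨c, hc, hp⟩ := ih₃ hl'
      exact ⟨c, hc, by simpa [ClockVal.reset_nil] using hp.delay d⟩
    · simp only at hl ⊢
      subst hl
      refine ⟨by omega, by omega, fun _ => ?_⟩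
      obtain ⟨c, hc, hp⟩ := ih₃ hl'
      exact ⟨c, hc, (hp.delay d).reset_period (by simpa [Guard.Sat, Cmp.holds, boundVal] using hg)⟩

end Soundness

/-! ### Completeness of the simulation for large integer periods -/

/-- The clock valuation `w` represents the values of the registers below `K` for the period `P`,
clock `0` is `t`, and all clocks have natural number values smaller than `P`. -/
def Canonical (P K t : ℕ) (c : ℕ → ℕ) (w : ClockVal) : Prop :=
  t < P ∧ w 0 = t ∧
    ∀ i < K, c i < P ∧ w (i + 1) = ((if c i ≤ t then t - c i else t + P - c i : ℕ) : ℝ≥0)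

section Completeness

variable {N K : ℕ} {E : List (ℕ × Instr × ℕ)} {a b n : ℕ} {v : ParamVal} {P : ℕ}

/-- The period loops are taken one after the other without delay. -/
theorem flowPTA_rotate {l : ℕ} (hl : l < N) (w : ClockVal) (xs : List ℕ)
    (hxs : ∀ x ∈ xs, x < K + 1) (hv : v 1 = P) :
    ReflTransGen ((flowPTA N K E a b n).Step v) (l, w)
      (l, fun x => if x ∈ xs ∧ w x = P then 0 else w x) := by
  induction xs with
  | nil => simpa using ReflTransGen.refl
  | cons y xs ih =>
    have ih := ih fun x hx => hxs x (List.mem_cons_of_mem _ hx)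
    -- A repeated clock has already been treated, so a further loop is taken only at a first
    -- occurrence.
    by_cases hy : y ∉ xs ∧ w y = P
    · set w' : ClockVal := fun x => if x ∈ xs ∧ w x = P then 0 else w x with hw'
      have hw'y : w' y = P := by simp [hw', hy.1, hy.2]
      have := flowPTA_step (w := w') 0 (mem_flowPTA_edges (E := E) (a := a) (b := b) (n := n).2
        (.inr (.inr (.inr (.inr (.inr ⟨l, hl, y, hxs y (List.mem_cons_self ..), rfl⟩))))))
        rfl (by simp only; omega) (by simp only; omega) (v := v)
        (by simp [Guard.Sat, Cmp.holds, boundVal, ClockVal.delay_zero, hw'y, hv])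
      refine ReflTransGen.tail ih ?_
      convert! this using 2
      funext x
      simp only [ClockVal.delay_zero, ClockVal.reset, List.mem_cons, List.not_mem_nil, or_false, hw']
      by_cases hxy : x = y
      · simp [hxy, hy.2]
      · simp [hxy]
    · convert! ih using 2
      funext x
      by_cases hxy : x = y
      · subst hxy
        by_cases hx : x ∈ xs <;> simp_all
      · simp [hxy]

/-- The unguarded self-loop ends a delay of one unit, since every delay must be followed by an edge.
At integer times no clock jumps past `P`, and the clocks that have just reached it are wrapped to
`0`. -/
theorem flowPTA_tick {l t : ℕ} (hl : l < N) {w : ClockVal} {c : ℕ → ℕ} (hv : v 1 = P)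
    (hw : Canonical P K t c w) :
    ∃ w', ReflTransGen ((flowPTA N K E a b n).Step v) (l, w) (l, w') ∧
      Canonical P K ((t + 1) % P) c w' := by
  obtain ⟨htP, hw0, hw⟩ := hw
  have hidle := flowPTA_step (w := w) 1 (mem_flowPTA_edges (E := E) (a := a) (b := b)
    (n := n) (K := K).2 (.inr (.inr (.inr (.inr (.inl ⟨l, hl, rfl⟩))))))
    rfl (by simp only; omega) (by simp only; omega) (v := v) (by simp [Guard.Sat])
  rw [ClockVal.reset_nil] at hidle
  refine ⟨_, .head hidle (flowPTA_rotate hl (w.delay 1) (List.range (K + 1)) (by simp) hv), ?_⟩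
  have hmod : (t + 1) % P = if t + 1 = P then 0 else t + 1 := by
    split_ifs with h
    · rw [h, Nat.mod_self]
    · exact Nat.mod_eq_of_lt (by omega)
  have hcast : ∀ m : ℕ, ((m : ℝ≥0) + 1 = P ↔ m + 1 = P) := fun m => by norm_cast
  rw [hmod]
  refine ⟨by split_ifs <;> omega, ?_, fun i hi => ⟨(hw i hi).1, ?_⟩⟩
  · simp only [List.mem_range, ClockVal.delay, hw0, hcast]
    split_ifs <;> first | omega | simp
  · have hi' : i + 1 ∈ List.range (K + 1) := by simpa using hi
    have hc := (hw i hi).1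
    simp only [hi', true_and, ClockVal.delay, (hw i hi).2, hcast]
    rw [← Nat.cast_succ, ← Nat.cast_zero, ← Nat.cast_ite, Nat.cast_inj]
    split_ifs <;> omega

theorem flowPTA_wait {l t : ℕ} (hl : l < N) {w : ClockVal} {c : ℕ → ℕ} (hv : v 1 = P)
    (hw : Canonical P K t c w) {t' : ℕ} (ht' : t' < P) :
    ∃ w', ReflTransGen ((flowPTA N K E a b n).Step v) (l, w) (l, w') ∧
      Canonical P K t' c w' := by
  have key : ∀ m, ∃ w', ReflTransGen ((flowPTA N K E a b n).Step v) (l, w) (l, w') ∧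
      Canonical P K ((t + m) % P) c w' := by
    intro m
    induction m with
    | zero => exact ⟨w, .refl, by rwa [add_zero, Nat.mod_eq_of_lt hw.1]⟩
    | succ m ih =>
      obtain ⟨w', h, hw'⟩ := ih
      obtain ⟨w'', h', hw''⟩ := flowPTA_tick hl hv hw'
      rw [Nat.mod_add_mod] at hw''
      exact ⟨w'', h.trans h', hw''⟩
  -- Adding a full turn `P` keeps the number of ticks nonnegative when `t' < t`.
  obtain ⟨w', h, hw'⟩ := key (t' + P - t)
  have : t + (t' + P - t) = t' + P := by have := hw.1; omega
  rw [this, Nat.add_mod_right, Nat.mod_eq_of_lt ht'] at hw'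
  exact ⟨w', h, hw'⟩

theorem Canonical.reset_register {t : ℕ} {c : ℕ → ℕ} {w : ClockVal} (hw : Canonical P K t c w)
    (j : ℕ) : Canonical P K t (update c j t) (w.reset [j + 1]) := by
  obtain ⟨ht, hw0, hw⟩ := hw
  refine ⟨ht, by simpa [ClockVal.reset] using hw0, fun i hi => ?_⟩
  by_cases hij : i = j
  · subst hij
    simpa [ClockVal.reset] using ht
  · simpa [ClockVal.reset, hij] using hw i hi

/-- The simulation waits until clock `0` shows `0` for `zero`, `c j + 1` for `inc j`, and `c i` for
`eq i j`; the guard then holds. Only an increment can push a register up to `P`, so only then is a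
bound on `c'` required. -/
theorem flowPTA_instr {q q' : ℕ} {i : Instr} (he : (q, i, q') ∈ E) (hq : q < N) (hq' : q' < N)
    (hi : i.RegsLT K) {t : ℕ} {c c' : ℕ → ℕ} (hr : i.Rel c c') (hc : ∀ j, i = .inc j → c' j < P)
    {w : ClockVal} (hv : v 1 = P) (hw : Canonical P K t c w) :
    ∃ t' w', ReflTransGen ((flowPTA N K E a b n).Step v) (q, w) (q', w') ∧
      Canonical P K t' c' w' := by
  have hedge := mem_flowPTA_edges (a := a) (b := b) (n := n) (N := N) (K := K).2
    (.inr (.inr (.inr (.inl ⟨q, i, q', he, rfl⟩))))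
  have step : ∀ w, i.guard.Sat v w →
      (flowPTA N K E a b n).Step v (q, w) (q', w.reset i.resets) := fun w hg => by
    have := flowPTA_step (w := w) 0 hedge rfl (by simp only; omega) (by simp only; omega)
      (by rwa [ClockVal.delay_zero])
    rwa [ClockVal.delay_zero] at this
  cases i with
  | zero j =>
    obtain rfl : c' = _ := hr
    obtain ⟨w', h, hw'⟩ := flowPTA_wait (E := E) (a := a) (b := b) (n := n) hq hv hw
      (t' := 0) (by have := hw.1; omega)
    refine ⟨_, _, h.tail (step w' ?_), hw'.reset_register j⟩
    simp [Guard.Sat, Instr.guard, Cmp.holds, boundVal, hw'.2.1]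
  | inc j =>
    obtain rfl : c' = _ := hr
    have hc := hc j rfl
    rw [update_self] at hc
    obtain ⟨w', h, hw'⟩ := flowPTA_wait (E := E) (a := a) (b := b) (n := n) hq hv hw hc
    refine ⟨_, _, h.tail (step w' ?_), hw'.reset_register j⟩
    have hj := (hw'.2.2 j hi).2
    rw [if_pos (by omega), Nat.add_sub_cancel_left] at hj
    simp only [Instr.guard, Guard.Sat, List.mem_cons, List.not_mem_nil, or_false,
      forall_eq_or_imp, forall_eq, Cmp.holds, boundVal, hj, hw'.2.1, hv, ge_iff_le,
      NNRat.cast_natCast, Nat.cast_le, Nat.cast_lt]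
    exact ⟨trivial, by omega, hc⟩
  | eq i j =>
    obtain ⟨hij, rfl⟩ := hr
    have hci := (hw.2.2 i hi.1).1
    obtain ⟨w', h, hw'⟩ := flowPTA_wait (E := E) (a := a) (b := b) (n := n) hq hv hw hci
    refine ⟨_, _, h.tail (step w' ?_), by rwa [Instr.resets, ClockVal.reset_nil]⟩
    have h₁ := (hw'.2.2 i hi.1).2
    have h₂ := (hw'.2.2 j hi.2).2
    rw [if_pos le_rfl, Nat.sub_self] at h₁
    rw [if_pos hij.ge, hij, Nat.sub_self] at h₂
    simp [Guard.Sat, Instr.guard, Cmp.holds, boundVal, h₁, h₂]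

/-- The bound `B` exceeds the input and every value produced by an increment along the run. Asking
for all `P ≥ B` lets the bound grow with the run. -/
theorem flowPTA_complete (ha : a < N) (hE : ∀ e ∈ E, e.1 < N ∧ e.2.2 < N)
    (hEK : ∀ e ∈ E, e.2.1.RegsLT K) {s : ℕ × (ℕ → ℕ)}
    (h : ReflTransGen (FlowStep E) (a, update (fun _ => 0) 0 n) s) :
    s.1 < N ∧ ∃ B : ℕ, ∀ P ≥ B, ∀ v : ParamVal, v 1 = P → ∃ t w,
      ReflTransGen ((flowPTA N K E a b n).Step v) (flowPTA N K E a b n).initState (s.1, w) ∧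
        Canonical P K t s.2 w := by
  induction h with
  | refl =>
    refine ⟨ha, n + 1, fun P hP v hv => ⟨n, _, .single (flowPTA_step n
      (mem_flowPTA_edges.2 (.inl rfl)) rfl ?_ ?_ ?_), by omega, ?_, fun i hi => ?_⟩⟩
    · simp [flowPTA]
    · simp only [inputEdge]; omega
    · simp only [inputEdge, Guard.Sat, List.mem_cons, List.not_mem_nil, or_false,
        forall_eq_or_imp, forall_eq, Cmp.holds, boundVal, ClockVal.delay, zero_add, hv,
        NNRat.cast_natCast, Nat.cast_lt]
      exact ⟨trivial, by omega⟩
    · simp [inputEdge, ClockVal.reset, ClockVal.delay]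
    · by_cases hi0 : i = 0
      · subst hi0
        simp [inputEdge, ClockVal.reset]
        omega
      · simp [inputEdge, ClockVal.reset, ClockVal.delay, hi0]
        omega
  | @tail s s' _ hstep ih =>
    obtain ⟨i, he, hr⟩ := hstep
    obtain ⟨hs, B, ih⟩ := ih
    refine ⟨(hE _ he).2, ?_⟩
    obtain ⟨B', hB'⟩ : ∃ B', ∀ j, i = .inc j → s'.2 j < B' := by
      cases i with
      | inc j => exact ⟨s'.2 j + 1, by rintro _ ⟨⟩; omega⟩
      | _ => exact ⟨0, by simp⟩
    refine ⟨max B B', fun P hP v hv => ?_⟩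
    obtain ⟨t, w, h, hw⟩ := ih P ((le_max_left _ _).trans hP) v hv
    obtain ⟨t', w', h', hw'⟩ := flowPTA_instr (a := a) (b := b) (n := n) he hs (hE _ he).2
      (hEK _ he) hr (fun j hj => (hB' j hj).trans_le ((le_max_right _ _).trans hP)) hv hw
    exact ⟨t', w', h.trans h', hw'⟩

end Completeness

/-! ### The reduction and its computability -/

theorem flowPTA_reachValues {N K : ℕ} {E : List (ℕ × Instr × ℕ)} {a b : ℕ} (n : ℕ)
    (ha : a < N) (hb : b < N) (hE : ∀ e ∈ E, e.1 < N ∧ e.2.2 < N)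
    (hEK : ∀ e ∈ E, e.2.1.RegsLT K) (c : ℚ≥0) :
    c ∈ (flowPTA N K E a b n).reachValues 0 [N + 1] ↔ c = 1 ∨
      c = 0 ∧ ∃ s, ReflTransGen (FlowStep E) (a, update (fun _ => 0) 0 n) (b, s) := by
  constructor
  · rintro ⟨v, ⟨l, hl, w, -, h⟩, rfl⟩
    exact (flowPTA_sound ha hb hE h).2.1 (by simpa using hl)
  · have hinit : ∀ v, (flowPTA N K E a b n).IsState v (flowPTA N K E a b n).initState :=
      fun v => flowPTA_isState.2 (by simp [PTA.initState, flowPTA])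
    rintro (rfl | ⟨rfl, s, h⟩)
    · refine ⟨fun _ => 1, ⟨N + 1, by simp, _, hinit _, .single (flowPTA_step 1
        (mem_flowPTA_edges.2 (.inr (.inl rfl))) rfl (by simp [flowPTA]) (by simp) ?_)⟩, rfl⟩
      simp [Guard.Sat, Cmp.holds, boundVal, ClockVal.delay]
    · obtain ⟨-, B, hB⟩ := flowPTA_complete (b := b) (K := K) ha hE hEK h
      obtain ⟨t, w, hr, hw⟩ := hB B le_rfl (fun i => if i = 0 then 0 else B) (by simp)
      obtain ⟨w', hr', hw'⟩ := flowPTA_wait (E := E) (a := a) (b := b) (n := n)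
        (v := fun i => if i = 0 then 0 else B) hb (by simp) hw (t' := 0)
        (by have := hw.1; omega)
      refine ⟨_, ⟨N + 1, by simp, _, hinit _, (hr.trans hr').tail (flowPTA_step 0
        (mem_flowPTA_edges.2 (.inr (.inr (.inl rfl)))) rfl (by omega) (by simp) ?_)⟩, by simp⟩
      simp [Guard.Sat, Cmp.holds, boundVal, ClockVal.delay_zero, hw'.2.1]

section Computability

theorem Primrec.atom_mk {α : Type} [Primcodable α] {f : α → ℕ} {g : α → Cmp} {h : α → ℕ ⊕ ℕ}
    (hf : Primrec f) (hg : Primrec g) (hh : Primrec h) :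
    Primrec fun x => Atom.mk (f x) (g x) (h x) :=
  (Primrec.of_equiv_symm (e := Atom.equivProd)).comp (hf.pair (hg.pair hh))

theorem primrec_inputEdge (N a : ℕ) : Primrec (inputEdge N a) := by
  have h : Primrec fun n : ℕ => [Atom.mk 0 .eq (.inl n), Atom.mk 0 .lt (.inr 1)] :=
    Primrec.list_cons.comp
      (Primrec.atom_mk (.const 0) (.const Cmp.eq) Primrec.sumInl)
      (.const [Atom.mk 0 .lt (.inr 1)])
  exact (Primrec.of_equiv_symm (e := Edge.equivProd)).comp
    ((Primrec.const N).pair (h.pair (.const (0, [1], a))))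

/-- Only the input edge depends on `n`; all other data are constants. -/
theorem primrec_flowPTA (N K : ℕ) (E : List (ℕ × Instr × ℕ)) (a b : ℕ) :
    Primrec (flowPTA N K E a b) := by
  have h : Primrec fun n : ℕ => inputEdge N a n :: flowEdges N K E b :=
    Primrec.list_cons.comp (primrec_inputEdge N a) (.const _)
  exact (Primrec.of_equiv_symm (e := PTA.equivProd)).comp
    ((Primrec.const 1).pair ((Primrec.const (N + 2)).pair ((Primrec.const (K + 1)).pair
      ((Primrec.const 2).pair ((Primrec.const N).pair
        ((Primrec.const (List.replicate (N + 2) [])).pair h))))))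

end Computability

/-- There is a partial recursive function whose domain is not computable. -/
theorem exists_partrec_not_computablePred_dom :
    ∃ f : ℕ →. ℕ, Partrec f ∧ ¬ ComputablePred fun n => (f n).Dom := by
  refine ⟨fun n => Nat.Partrec.Code.eval (Denumerable.ofNat _ n) 0,
    Nat.Partrec.Code.eval_part.comp (Computable.ofNat _) (Computable.const 0), fun h => ?_⟩
  refine ComputablePred.halting_problem 0 ?_
  obtain ⟨_, h⟩ := h
  refine ⟨Classical.decPred _, (h.comp Computable.encode).of_eq fun c => ?_⟩
  simp

theorem ratOfCode_eq_zero_iff (q : ℕ × ℕ) : ratOfCode q = 0 ↔ q.1 = 0 := by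
  have : (q.2 : ℚ≥0) + 1 ≠ 0 := by positivity
  simp [ratOfCode, this]

/-- No partial recursive function computes the least value of a parameter for which a single
target location is reachable. -/
theorem not_exists_partrec_least :
    ¬ ∃ f : PTA × ℕ × ℕ →. ℕ × ℕ, Partrec f ∧
      ∀ (A : PTA) (p l : ℕ), A.WellFormed → p < A.params → l < A.locs →
        ∀ c : ℚ≥0, IsMinParamReach A p [l] (Minimum.attained c) →
          ∃ o ∈ f (A, p, l), ratOfCode o = c := by
  rintro ⟨f, hf, hspec⟩
  obtain ⟨g, hg, hgc⟩ := exists_partrec_not_computablePred_dom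
  obtain ⟨N, E, a, b, ha, hb, hE, hrun⟩ := exists_natFlow_of_partrec hg
  obtain ⟨K, hK, hEK⟩ := E.exists_regsLT
  set F : ℕ →. ℕ × ℕ := fun n => f (flowPTA N K E a b n, 0, N + 1) with hF
  have hFp : Partrec F := hf.comp ((primrec_flowPTA N K E a b).pair (.const (0, N + 1))).to_comp
  -- The equivalence is inside the existential: `F` is defined everywhere, because the minimum is
  -- attained for every `n`, and the numerator of its value decides the domain of `g`.
  have key : ∀ n, ∃ o ∈ F n, o.1 = 0 ↔ (g n).Dom := by
    intro n
    have hS := flowPTA_reachValues (K := K) n ha hb hE hEK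
    have hspec := hspec (flowPTA N K E a b n) 0 (N + 1) (flowPTA_wellFormed n hK ha hb hE hEK)
      (by simp [flowPTA]) (by simp [flowPTA])
    simp only [← hrun] at hS
    by_cases hd : (g n).Dom
    · obtain ⟨o, ho, h0⟩ := hspec 0 ⟨(hS 0).2 (.inr ⟨rfl, hd⟩), fun _ _ => zero_le⟩
      exact ⟨o, ho, by simp [hd, (ratOfCode_eq_zero_iff o).1 h0]⟩
    · obtain ⟨o, ho, h1⟩ := hspec 1 ⟨(hS 1).2 (.inl rfl), fun c hc => by
        rcases (hS c).1 hc with rfl | ⟨-, h⟩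
        · exact le_rfl
        · exact absurd h hd⟩
      refine ⟨o, ho, ?_⟩
      rw [← ratOfCode_eq_zero_iff, h1]
      simp [hd]
  choose o ho ho' using key
  have hoc : Computable o := hFp.of_eq fun n => Part.eq_some_iff.2 (ho n)
  refine hgc ⟨Classical.decPred _, ((Primrec.eq.decide.comp .id (.const 0)).to_comp.comp
    (Computable.fst.comp hoc)).of_eq fun n => ?_⟩
  simp [ho']

theorem mainTheorem4 :
    (¬ ∃ f : PTA × ℕ × List ℕ →. Option ((ℕ × ℕ) × Bool), Partrec f ∧
      ∀ (A : PTA) (p : ℕ) (T : List ℕ), A.WellFormed → p < A.params → (∀ l ∈ T, l < A.locs) →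
        ∀ m : Minimum, IsMinParamReach A p T m → ∃ o ∈ f (A, p, T), minimumOfCode o = m) ∧
    (¬ ∃ f : PTA × ℕ × ℕ →. ℕ × ℕ, Partrec f ∧
      ∀ (A : PTA) (p l : ℕ), A.WellFormed → p < A.params → l < A.locs →
        ∀ c : ℚ≥0, IsMinParamReach A p [l] (Minimum.attained c) →
          ∃ o ∈ f (A, p, l), ratOfCode o = c) := by
  refine ⟨?_, not_exists_partrec_least⟩
  rintro ⟨f, hf, hspec⟩
  refine not_exists_partrec_least
    -- The default is irrelevant: on instances with an attained minimum the answer is of the form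
    -- `some (q, true)`.
    ⟨fun x => (f (x.1, x.2.1, [x.2.2])).map fun o => (o.getD ((0, 0), false)).1, ?_, ?_⟩
  · have hin : Computable fun x : PTA × ℕ × ℕ => (x.1, x.2.1, [x.2.2]) :=
      (Primrec.fst.pair ((Primrec.fst.comp .snd).pair
        (Primrec.list_cons.comp (Primrec.snd.comp .snd) (.const [])))).to_comp
    have hout : Computable fun o : Option ((ℕ × ℕ) × Bool) => (o.getD ((0, 0), false)).1 :=
      Computable.fst.comp (Primrec.option_getD.comp .id (.const _)).to_comp
    exact (hf.comp hin).map (hout.comp .snd).to₂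
  · intro A p l hA hp hl c hc
    obtain ⟨o, ho, hoc⟩ := hspec A p [l] hA hp (by simpa using hl) _ hc
    refine ⟨_, Part.mem_map _ ho, ?_⟩
    match o, hoc with
    | some (q, true), hoc => simpa [minimumOfCode] using hoc
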